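/- For a permutation $\sigma\in\mathfrak S_n$ of $[n]=\{1,\dots,n\}$, an index $i$ is a record if $\sigma(j)<\sigma(i)$ for all $j<i$, an antirecord if $\sigma(j)>\sigma(i)$ for all $j>i$; it is an exclusive record (erec) if it is a record and not an antirecord, an exclusive antirecord (earec) if it is an antirecord and not a record, and "nr" if it is neither. An index $i$ is a cycle peak (cpeak) if $\sigma^{-1}(i)<i>\sigma(i)$, a cycle valley (cval) if $\sigma^{-1}(i)>i<\sigma(i)$, a cycle double rise (cdrise) if $\sigma^{-1}(i)<i<\sigma(i)$, and a cycle double fall (cdfall) if $\sigma^{-1}(i)>i>\sigma(i)$. Let $\mathrm{eareccpeak}(\sigma)$ be the number of indices that are both exclusive antirecords and cycle peaks, and define likewise $\mathrm{eareccdfall}$, $\mathrm{ereccval}$, $\mathrm{ereccdrise}$, $\mathrm{nrcpeak}$, $\mathrm{nrcdfall}$, $\mathrm{nrcval}$, $\mathrm{nrcdrise}$. A fixed point $i$ has level $\mathrm{lev}(i,\sigma)=\#\{j<i:\sigma(j)>i\}$; let $\mathrm{fix}(\sigma,\ell)$ be the number of fixed points of level $\ell$, and $\mathbf w^{\mathbf{fix}(\sigma)}=\prod_{\ell\ge0}w_\ell^{\mathrm{fix}(\sigma,\ell)}$,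 where $\mathbf w=(w_\ell)_{\ell\ge0}$. A quadruplet $i<j<k<l$ is an upper crossing if $k=\sigma(i)$ and $l=\sigma(j)$, an upper nesting if $l=\sigma(i)$ and $k=\sigma(j)$, a lower crossing if $i=\sigma(k)$ and $j=\sigma(l)$, and a lower nesting if $i=\sigma(l)$ and $j=\sigma(k)$. An upper crossing or nesting is of type cval if $\sigma^{-1}(j)>j$ and of type cdrise if $\sigma^{-1}(j)<j$; a lower crossing or nesting is of type cpeak if $\sigma^{-1}(k)<k$ and of type cdfall if $\sigma^{-1}(k)>k$. The numbers of these are denoted $\mathrm{ucrosscval}(\sigma)$, $\mathrm{ucrosscdrise}(\sigma)$, $\mathrm{lcrosscpeak}(\sigma)$, $\mathrm{lcrosscdfall}(\sigma)$, $\mathrm{unestcval}(\sigma)$, $\mathrm{unestcdrise}(\sigma)$, $\mathrm{lnestcpeak}(\sigma)$, $\mathrm{lnestcdfall}(\sigma)$. Let $\mathrm{psnest}(\sigma)$ be the number of triplets $i<j<l$ with $l=\sigma(i)$ and $j=\sigma(j)$. Let $[n]_{p,q}=\sum_{j=0}^{n-1}p^jq^{n-1-j}$ for $n\ge0$. Define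 the polynomials $$Q_n=\sum_{\sigma\in\mathfrak S_n} x_1^{\mathrm{eareccpeak}(\sigma)}x_2^{\mathrm{eareccdfall}(\sigma)}y_1^{\mathrm{ereccval}(\sigma)}y_2^{\mathrm{ereccdrise}(\sigma)}\, u_1^{\mathrm{nrcpeak}(\sigma)}u_2^{\mathrm{nrcdfall}(\sigma)}v_1^{\mathrm{nrcval}(\sigma)}v_2^{\mathrm{nrcdrise}(\sigma)}\,\mathbf w^{\mathbf{fix}(\sigma)}$$ $$\qquad\times\;p_{+1}^{\mathrm{ucrosscval}(\sigma)}p_{+2}^{\mathrm{ucrosscdrise}(\sigma)}p_{-1}^{\mathrm{lcrosscpeak}(\sigma)}p_{-2}^{\mathrm{lcrosscdfall}(\sigma)}\, q_{+1}^{\mathrm{unestcval}(\sigma)}q_{+2}^{\mathrm{unestcdrise}(\sigma)}q_{-1}^{\mathrm{lnestcpeak}(\sigma)}q_{-2}^{\mathrm{lnestcdfall}(\sigma)}\,s^{\mathrm{psnest}(\sigma)}$$ in the variables $x_1,x_2,y_1,y_2,u_1,u_2,v_1,v_2$, $w_\ell$ ($\ell\ge0$), $p_{\pm1},p_{\pm2},q_{\pm1},q_{\pm2},s$.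 Theorem. As formal power series in $t$, for indeterminates over $\mathbb Z$ (equivalently, for arbitrary elements of any commutative ring in place of the variables), $$\sum_{n=0}^\infty Q_n\,t^n=\cfrac{1}{1-\gamma_0t-\cfrac{\beta_1t^2}{1-\gamma_1t-\cfrac{\beta_2t^2}{1-\cdots}}}$$ (the convergents of the right-hand side tend coefficientwise to the left-hand side), where $\gamma_0=w_0$ and, for $n\ge1$, $$\gamma_n=\bigl(p_{-2}^{n-1}x_2+q_{-2}[n-1]_{p_{-2},q_{-2}}u_2\bigr)+\bigl(p_{+2}^{n-1}y_2+q_{+2}[n-1]_{p_{+2},q_{+2}}v_2\bigr)+s^nw_n,$$ $$\beta_n=\bigl(p_{-1}^{n-1}x_1+q_{-1}[n-1]_{p_{-1},q_{-1}}u_1\bigr)\bigl(p_{+1}^{n-1}y_1+q_{+1}[n-1]_{p_{+1},q_{+1}}v_1\bigr).$$ -/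

import Mathlib

open PowerSeries in
/-- The convergents of the J-type continued fraction started at level `k`:
`jConvergent γ β 0 k = 0` and
`jConvergent γ β (N + 1) k = 1 / (1 - γ k * t - β (k + 1) * t ^ 2 * jConvergent γ β N (k + 1))`,
so that `jConvergent γ β (N + 1) 0` is the fraction
`1 / (1 - γ₀ t - β₁ t² / (1 - γ₁ t - ⋯ - β_N t² / (1 - γ_N t)))`.
The denominators have constant term `1`, so `invOfUnit _ 1` is the true inverse
(see `PermJFrac.denominator_mul_jConvergent`). -/
noncomputable def PermJFrac.jConvergent {R : Type*} [CommRing R] (γ β : ℕ → R) :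
    ℕ → ℕ → PowerSeries R
  | 0, _ => 0
  | N + 1, k =>
      PowerSeries.invOfUnit
        (1 - C (γ k) * X - C (β (k + 1)) * X ^ 2 * PermJFrac.jConvergent γ β N (k + 1)) 1

namespace PermJFrac

open PowerSeries in
theorem denominator_mul_jConvergent {R : Type*} [CommRing R] (γ β : ℕ → R) (N k : ℕ) :
    (1 - C (γ k) * X - C (β (k + 1)) * X ^ 2 * jConvergent γ β N (k + 1)) *
      jConvergent γ β (N + 1) k = 1 := by
  rw [jConvergent]
  exact PowerSeries.mul_invOfUnit _ 1 (by simp)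

/-- `F` is, as a formal power series, the J-type continued fraction
`1 / (1 - γ₀ t - β₁ t² / (1 - γ₁ t - β₂ t² / (1 - ⋯)))`: the convergents tend to `F`, i.e.
each coefficient of the convergents is eventually equal to that of `F`.
The value `β 0` plays no role. -/
def IsJFraction {R : Type*} [CommRing R] (F : PowerSeries R) (γ β : ℕ → R) : Prop :=
  ∀ n : ℕ, ∀ᶠ N in Filter.atTop,
    PowerSeries.coeff n (jConvergent γ β N 0) = PowerSeries.coeff n F

/-- The `p,q`-integer `[n]_{p,q} = ∑_{j=0}^{n-1} p^j q^{n-1-j}`. -/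
def pqInt {R : Type*} [CommRing R] (p q : R) (n : ℕ) : R :=
  ∑ j ∈ Finset.range n, p ^ j * q ^ (n - 1 - j)

/-! Permutations of `[n]` are modelled by `Equiv.Perm (Fin n)`; all statistics below depend only
on the order of the index set. -/

variable {n : ℕ}

/-! ### Record classification -/

/-- Record (left-to-right maximum). -/
abbrev IsRec (σ : Equiv.Perm (Fin n)) (i : Fin n) : Prop := ∀ j, j < i → σ j < σ i

/-- Antirecord (right-to-left minimum). -/
abbrev IsArec (σ : Equiv.Perm (Fin n)) (i : Fin n) : Prop := ∀ j, i < j → σ i < σ j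

/-- Exclusive record. -/
abbrev IsErec (σ : Equiv.Perm (Fin n)) (i : Fin n) : Prop := IsRec σ i ∧ ¬ IsArec σ i

/-- Exclusive antirecord. -/
abbrev IsEarec (σ : Equiv.Perm (Fin n)) (i : Fin n) : Prop := IsArec σ i ∧ ¬ IsRec σ i

/-- Neither-record-antirecord. -/
abbrev IsNrar (σ : Equiv.Perm (Fin n)) (i : Fin n) : Prop := ¬ IsRec σ i ∧ ¬ IsArec σ i

/-! ### Cycle classification -/

/-- Cycle peak. -/
abbrev IsCpeak (σ : Equiv.Perm (Fin n)) (i : Fin n) : Prop := σ.symm i < i ∧ σ i < i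

/-- Cycle valley. -/
abbrev IsCval (σ : Equiv.Perm (Fin n)) (i : Fin n) : Prop := i < σ.symm i ∧ i < σ i

/-- Cycle double rise. -/
abbrev IsCdrise (σ : Equiv.Perm (Fin n)) (i : Fin n) : Prop := σ.symm i < i ∧ i < σ i

/-- Cycle double fall. -/
abbrev IsCdfall (σ : Equiv.Perm (Fin n)) (i : Fin n) : Prop := i < σ.symm i ∧ σ i < i

/-! ### Record-and-cycle statistics -/

/-- Number of indices satisfying `P`. -/
def countIdx (P : Fin n → Prop) [DecidablePred P] : ℕ := (Finset.univ.filter P).card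

def eareccpeak (σ : Equiv.Perm (Fin n)) : ℕ := countIdx fun i => IsEarec σ i ∧ IsCpeak σ i
def eareccdfall (σ : Equiv.Perm (Fin n)) : ℕ := countIdx fun i => IsEarec σ i ∧ IsCdfall σ i
def ereccval (σ : Equiv.Perm (Fin n)) : ℕ := countIdx fun i => IsErec σ i ∧ IsCval σ i
def ereccdrise (σ : Equiv.Perm (Fin n)) : ℕ := countIdx fun i => IsErec σ i ∧ IsCdrise σ i
def nrcpeak (σ : Equiv.Perm (Fin n)) : ℕ := countIdx fun i => IsNrar σ i ∧ IsCpeak σ i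
def nrcdfall (σ : Equiv.Perm (Fin n)) : ℕ := countIdx fun i => IsNrar σ i ∧ IsCdfall σ i
def nrcval (σ : Equiv.Perm (Fin n)) : ℕ := countIdx fun i => IsNrar σ i ∧ IsCval σ i
def nrcdrise (σ : Equiv.Perm (Fin n)) : ℕ := countIdx fun i => IsNrar σ i ∧ IsCdrise σ i

/-- The level `lev(i,σ) = #{j < i : σ(j) > i}`, used for fixed points `i`. -/
def lev (i : Fin n) (σ : Equiv.Perm (Fin n)) : ℕ := countIdx fun j => j < i ∧ i < σ j

/-- The number `fix(σ,ℓ)` of fixed points of level `ℓ`. -/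
def fixLev (σ : Equiv.Perm (Fin n)) (l : ℕ) : ℕ := countIdx fun i => σ i = i ∧ lev i σ = l

/-- `w^{fix(σ)} = ∏_ℓ w_ℓ^{fix(σ,ℓ)}`.  A level is always less than `n`, so the product
over `ℓ < n` contains all nontrivial factors. -/
def wFix {R : Type*} [CommRing R] (w : ℕ → R) (σ : Equiv.Perm (Fin n)) : R :=
  ∏ l ∈ Finset.range n, w l ^ fixLev σ l

/-! ### Crossings and nestings -/

/-- Number of quadruplets `i < j < k < l` satisfying `P`. -/
def countQuad (P : Fin n → Fin n → Fin n → Fin n → Prop)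
    [∀ i j k l, Decidable (P i j k l)] : ℕ :=
  (Finset.univ.filter fun a : Fin n × Fin n × Fin n × Fin n =>
    a.1 < a.2.1 ∧ a.2.1 < a.2.2.1 ∧ a.2.2.1 < a.2.2.2 ∧ P a.1 a.2.1 a.2.2.1 a.2.2.2).card

/-- Upper crossings of type cval. -/
def ucrosscval (σ : Equiv.Perm (Fin n)) : ℕ :=
  countQuad fun i j k l => k = σ i ∧ l = σ j ∧ j < σ.symm j

/-- Upper crossings of type cdrise. -/
def ucrosscdrise (σ : Equiv.Perm (Fin n)) : ℕ :=
  countQuad fun i j k l => k = σ i ∧ l = σ j ∧ σ.symm j < j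

/-- Lower crossings of type cpeak. -/
def lcrosscpeak (σ : Equiv.Perm (Fin n)) : ℕ :=
  countQuad fun i j k l => i = σ k ∧ j = σ l ∧ σ.symm k < k

/-- Lower crossings of type cdfall. -/
def lcrosscdfall (σ : Equiv.Perm (Fin n)) : ℕ :=
  countQuad fun i j k l => i = σ k ∧ j = σ l ∧ k < σ.symm k

/-- Upper nestings of type cval. -/
def unestcval (σ : Equiv.Perm (Fin n)) : ℕ :=
  countQuad fun i j k l => l = σ i ∧ k = σ j ∧ j < σ.symm j

/-- Upper nestings of type cdrise. -/
def unestcdrise (σ : Equiv.Perm (Fin n)) : ℕ :=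
  countQuad fun i j k l => l = σ i ∧ k = σ j ∧ σ.symm j < j

/-- Lower nestings of type cpeak. -/
def lnestcpeak (σ : Equiv.Perm (Fin n)) : ℕ :=
  countQuad fun i j k l => i = σ l ∧ j = σ k ∧ σ.symm k < k

/-- Lower nestings of type cdfall. -/
def lnestcdfall (σ : Equiv.Perm (Fin n)) : ℕ :=
  countQuad fun i j k l => i = σ l ∧ j = σ k ∧ k < σ.symm k

/-- Pseudo-nestings: triplets `i < j < l` with `l = σ(i)` and `j = σ(j)`
(upper pseudo-nestings; for every permutation there are as many lower ones, `i = σ(l)`). -/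
def psnest (σ : Equiv.Perm (Fin n)) : ℕ :=
  (Finset.univ.filter fun a : Fin n × Fin n × Fin n =>
    a.1 < a.2.1 ∧ a.2.1 < a.2.2 ∧ a.2.2 = σ a.1 ∧ a.2.1 = σ a.2.1).card

/-- The master polynomial `Q_n`, evaluated in a commutative ring.  The arguments `pa1`, `pa2`,
`pb1`, `pb2` stand for `p_{+1}`, `p_{+2}`, `p_{-1}`, `p_{-2}`, and similarly for `q`. -/
def Q {R : Type*} [CommRing R] (n : ℕ) (x1 x2 y1 y2 u1 u2 v1 v2 : R) (w : ℕ → R)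
    (pa1 pa2 pb1 pb2 qa1 qa2 qb1 qb2 s : R) : R :=
  ∑ σ : Equiv.Perm (Fin n),
    x1 ^ eareccpeak σ * x2 ^ eareccdfall σ * y1 ^ ereccval σ * y2 ^ ereccdrise σ *
    (u1 ^ nrcpeak σ * u2 ^ nrcdfall σ * v1 ^ nrcval σ * v2 ^ nrcdrise σ) * wFix w σ *
    (pa1 ^ ucrosscval σ * pa2 ^ ucrosscdrise σ * pb1 ^ lcrosscpeak σ * pb2 ^ lcrosscdfall σ) *
    (qa1 ^ unestcval σ * qa2 ^ unestcdrise σ * qb1 ^ lnestcpeak σ * qb2 ^ lnestcdfall σ) *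
    s ^ psnest σ

end PermJFrac

/-! Each index `i` of a permutation is recorded by its cyclic type `kind` and by `rank`, the number
of nestings in which the arc leaving `i` is the inner one. Read from left to right, the types trace
a Motzkin path whose height before `i` is the number `openCount` of arcs from below `i` to `i` or
beyond; the ranks label its steps. Height and rank determine the crossings charged to `i`
(`cross_add_rank_of_lt`, `cross_add_rank_of_gt`), and vanishing rank detects (anti)records, so the
weight of `σ` is a product of step weights (`Q_eq_sum_prod`).

The code determines `σ`: on excedances, and dually on anti-excedances, the types give domain and
image and the ranks give an inversion table (`eq_of_kind_rank`). No inverse map is built. The closed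
labelled paths number `n!` (`card_codes`), so the injective coding is onto them
(`image_prefixCode`). Summing over labels gives weighted Motzkin paths, whose generating function is
the J-fraction by Flajolet's theorem (`isJFraction_motzkin`). -/

namespace PermJFrac

/-! ### Weighted Motzkin paths and J-fractions. -/

section Motzkin

variable {R : Type*} [CommRing R]

/-- Total weight of the Motzkin paths of length `n` from height `0` to height `h`, where a rise
from `k` to `k + 1` has weight `U k`, a level step at `k` has weight `γ k` and a fall from `k + 1`
to `k` has weight `L k`. -/
def motzkin (U γ L : ℕ → R) : ℕ → ℕ → R
  | 0, 0 => 1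
  | 0, _ + 1 => 0
  | n + 1, 0 => γ 0 * motzkin U γ L n 0 + L 0 * motzkin U γ L n 1
  | n + 1, h + 1 => U h * motzkin U γ L n h + γ (h + 1) * motzkin U γ L n (h + 1) +
      L (h + 1) * motzkin U γ L n (h + 2)

theorem motzkin_eq_zero (U γ L : ℕ → R) :
    ∀ n h : ℕ, n < h → motzkin U γ L n h = 0
  | 0, h + 1, _ => rfl
  | n + 1, h + 1, hn => by
      rw [motzkin, motzkin_eq_zero U γ L n h (by omega),
        motzkin_eq_zero U γ L n (h + 1) (by omega), motzkin_eq_zero U γ L n (h + 2) (by omega)]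
      simp

/-- Truncated generating function of the Motzkin paths ending at height `h`. -/
noncomputable def pathSeries (U γ β : ℕ → R) (N h : ℕ) : PowerSeries R :=
  PowerSeries.C (∏ i ∈ Finset.range h, U i) * PowerSeries.X ^ h *
    ∏ i ∈ Finset.range (h + 1), jConvergent γ β (N - i) i

theorem pathSeries_eq_zero (U γ β : ℕ → R) {N h : ℕ} (hN : N ≤ h) :
    pathSeries U γ β N h = 0 := by
  -- The factor with `i = N` is the convergent of depth `0`, which is zero.
  rw [pathSeries, Finset.prod_eq_zero (s := Finset.range (h + 1)) (i := N)
    (Finset.mem_range.2 (Nat.lt_succ_of_le hN)) (by rw [Nat.sub_self, jConvergent]), mul_zero]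

theorem pathSeries_zero (U γ β L : ℕ → R) (hβ : ∀ h, β (h + 1) = U h * L h) {N : ℕ} (hN : 0 < N) :
    pathSeries U γ β N 0 = 1 + PowerSeries.X *
      (PowerSeries.C (γ 0) * pathSeries U γ β N 0 + PowerSeries.C (L 0) * pathSeries U γ β N 1) := by
  obtain ⟨N, rfl⟩ : ∃ m, N = m + 1 := ⟨N - 1, by omega⟩
  have h := denominator_mul_jConvergent γ β N 0
  rw [hβ, map_mul] at h
  simp only [pathSeries, Finset.prod_range_succ, Finset.prod_range_zero, Nat.add_sub_cancel,
    Nat.sub_zero, zero_add, one_mul, map_one, pow_zero, pow_one] at h ⊢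
  linear_combination h

/-- Decomposition by the last step. It is the equation of the convergent at level `h + 1`,
multiplied by the factors belonging to the lower levels. -/
theorem pathSeries_succ (U γ β L : ℕ → R) (hβ : ∀ h, β (h + 1) = U h * L h) {N h : ℕ}
    (hN : h + 1 < N) :
    pathSeries U γ β N (h + 1) = PowerSeries.X *
      (PowerSeries.C (U h) * pathSeries U γ β N h +
        PowerSeries.C (γ (h + 1)) * pathSeries U γ β N (h + 1) +
        PowerSeries.C (L (h + 1)) * pathSeries U γ β N (h + 2)) := by
  have h' := denominator_mul_jConvergent γ β (N - (h + 2)) (h + 1)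
  rw [hβ, map_mul, show N - (h + 2) + 1 = N - (h + 1) by omega] at h'
  simp only [pathSeries]
  rw [Finset.prod_range_succ _ (h + 2), Finset.prod_range_succ _ (h + 1),
    Finset.prod_range_succ _ (h + 1), Finset.prod_range_succ _ h]
  simp only [map_mul, pow_succ]
  generalize (∏ x ∈ Finset.range (h + 1), jConvergent γ β (N - x) x) = P
  linear_combination
    (PowerSeries.C (∏ i ∈ Finset.range h, U i) * PowerSeries.C (U h) * PowerSeries.X ^ h *
      PowerSeries.X * P) * h'

/-- Both sides obey the same last-step recursion at heights below `N`; heights from `N` on, where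
the truncation acts, are out of reach in `n < N` steps. -/
theorem coeff_pathSeries (U γ β L : ℕ → R) (hβ : ∀ h, β (h + 1) = U h * L h) (N : ℕ) :
    ∀ n h : ℕ, n < N → PowerSeries.coeff n (pathSeries U γ β N h) = motzkin U γ L n h := by
  intro n
  induction n with
  | zero =>
    intro h hN
    cases h with
    | zero =>
      rw [pathSeries_zero U γ β L hβ hN]
      simp [motzkin]
    | succ h =>
      rw [motzkin, pathSeries]
      simp
  | succ n ih =>
    intro h hN
    cases h with
    | zero =>
      rw [pathSeries_zero U γ β L hβ (by omega), map_add, PowerSeries.coeff_succ_X_mul]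
      simp [motzkin, ih _ (show n < N by omega), PowerSeries.coeff_one]
    | succ h =>
      by_cases hh : h + 1 < N
      · rw [pathSeries_succ U γ β L hβ hh, PowerSeries.coeff_succ_X_mul]
        simp [motzkin, ih _ (show n < N by omega)]
      · rw [pathSeries_eq_zero U γ β (by omega), motzkin_eq_zero U γ L _ _ (by omega), map_zero]

/-- Flajolet's theorem: the generating function of the weighted Motzkin paths from `0` to `0` is a
J-fraction. -/
theorem isJFraction_motzkin (U γ β L : ℕ → R) (hβ : ∀ h, β (h + 1) = U h * L h) :
    IsJFraction (PowerSeries.mk fun n => motzkin U γ L n 0) γ β := by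
  intro n
  filter_upwards [Filter.eventually_gt_atTop n] with N hN
  have := coeff_pathSeries U γ β L hβ N n 0 hN
  simpa [pathSeries] using this

/-- The Motzkin recursion with weights `h + 1`, `2 h + 1`, `h + 1`. -/
theorem motzkin_choose (n : ℕ) : ∀ h : ℕ,
    motzkin (fun h => (h : ℤ) + 1) (fun h => 2 * (h : ℤ) + 1) (fun h => (h : ℤ) + 1) n h =
      n.choose h * n.factorial := by
  induction n with
  | zero => intro h; cases h <;> simp [motzkin]
  | succ n ih =>
    intro h
    cases h with
    | zero =>
      simp [motzkin, ih, Nat.factorial_succ]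
      ring
    | succ h =>
      -- The absorption identity over `ℤ`; beyond the range of the binomial coefficients both sides
      -- vanish.
      have h1 : ((h : ℤ) + 1 + 1) * n.choose (h + 2) = (n - (h + 1)) * n.choose (h + 1) := by
        have := Nat.choose_succ_right_eq n (h + 1)
        rcases le_or_gt (h + 1) n with hn | hn
        · zify [hn] at this; linarith
        · simp [Nat.choose_eq_zero_of_lt hn, Nat.choose_eq_zero_of_lt (show n < h + 2 by omega)]
      have h2 : ((h : ℤ) + 1) * n.choose (h + 1) = (n - h) * n.choose h := by
        have := Nat.choose_succ_right_eq n h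
        rcases le_or_gt h n with hn | hn
        · zify [hn] at this; linarith
        · simp [Nat.choose_eq_zero_of_lt hn, Nat.choose_eq_zero_of_lt (show n < h + 1 by omega)]
      rw [motzkin, ih, ih, ih, Nat.factorial_succ, Nat.choose_succ_succ]
      push_cast
      linear_combination (n.factorial : ℤ) * (h1 + h2)

end Motzkin

/-! ### Codes -/

/-- The five cyclic types of an index. -/
inductive Kind
  | cval | cdrise | cpeak | cdfall | fix
  deriving DecidableEq

/-- The change of height along a step. -/
def stepHeight (h : ℕ) : Kind → ℕ
  | .cval => h + 1
  -- The truncation at `h = 0` is harmless, since `labels 0 .cpeak = 0`.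
  | .cpeak => h - 1
  | _ => h

/-- The height reached by a code (the last step is the head of the list). -/
def height : List (Kind × ℕ) → ℕ
  | [] => 0
  | k :: l => stepHeight (height l) k.1

/-- The number of labels of a step of each kind starting at height `h`. -/
def labels (h : ℕ) : Kind → ℕ
  | .cval => h + 1
  | .fix => 1
  | _ => h

def steps (h : ℕ) : Finset (Kind × ℕ) :=
  ({.cval, .cdrise, .cpeak, .cdfall, .fix} : Finset Kind).biUnion fun k =>
    (Finset.range (labels h k)).map (Function.Embedding.sectR k ℕ)

theorem mem_steps {h : ℕ} {k : Kind × ℕ} : k ∈ steps h ↔ k.2 < labels h k.1 := by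
  obtain ⟨k, a⟩ := k
  cases k <;> simp [steps]

theorem sum_steps {M : Type*} [AddCommMonoid M] (h : ℕ) (f : Kind × ℕ → M) :
    ∑ k ∈ steps h, f k = (∑ a ∈ Finset.range (h + 1), f (.cval, a)) +
      ((∑ a ∈ Finset.range h, f (.cdrise, a)) + ((∑ a ∈ Finset.range h, f (.cpeak, a)) +
      ((∑ a ∈ Finset.range h, f (.cdfall, a)) + f (.fix, 0)))) := by
  rw [steps, Finset.sum_biUnion]
  · simp [labels]
  · intro k _ k' _ hk
    rw [Function.onFun, Finset.disjoint_left]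
    intro a ha ha'
    simp only [Finset.mem_map, Function.Embedding.sectR_apply] at ha ha'
    obtain ⟨_, _, rfl⟩ := ha
    obtain ⟨_, _, h⟩ := ha'
    exact hk (congrArg Prod.fst h).symm

/-- Prepending to `l` as an embedding. -/
def consEmbedding (l : List (Kind × ℕ)) : Kind × ℕ ↪ List (Kind × ℕ) :=
  ⟨fun k => k :: l, fun _ _ h => (List.cons.inj h).1⟩

@[simp]
theorem consEmbedding_apply (l : List (Kind × ℕ)) (k : Kind × ℕ) :
    consEmbedding l k = k :: l := rfl

/-- Labelled Motzkin paths (Laguerre histories) of length `n`. -/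
def codes : ℕ → Finset (List (Kind × ℕ))
  | 0 => {[]}
  | n + 1 => (codes n).biUnion fun l =>
      (steps (height l)).map (consEmbedding l)

theorem cons_mem_codes {n : ℕ} {k : Kind × ℕ} {l : List (Kind × ℕ)} :
    k :: l ∈ codes (n + 1) ↔ l ∈ codes n ∧ k.2 < labels (height l) k.1 := by
  simp only [codes, Finset.mem_biUnion, Finset.mem_map, consEmbedding_apply, List.cons.injEq,
    mem_steps]
  constructor
  · rintro ⟨_, hl, _, hk, rfl, rfl⟩
    exact ⟨hl, hk⟩
  · rintro ⟨hl, hk⟩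
    exact ⟨l, hl, k, hk, rfl, rfl⟩

theorem sum_codes_succ {M : Type*} [AddCommMonoid M] (n : ℕ) (f : List (Kind × ℕ) → M) :
    ∑ l ∈ codes (n + 1), f l = ∑ l ∈ codes n, ∑ k ∈ steps (height l), f (k :: l) := by
  rw [codes, Finset.sum_biUnion]
  · simp
  · intro l _ l' _ hl
    rw [Function.onFun, Finset.disjoint_left]
    intro a ha ha'
    simp only [Finset.mem_map, consEmbedding_apply] at ha ha'
    obtain ⟨_, _, rfl⟩ := ha
    obtain ⟨_, _, h⟩ := ha'
    exact hl (List.cons.inj h).2.symm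

section Weight

variable {R : Type*} [CommRing R]

/-- The weight of a code, `W h k` being the weight of the step `k` starting at height `h`. -/
def codeWeight (W : ℕ → Kind × ℕ → R) : List (Kind × ℕ) → R
  | [] => 1
  | k :: l => W (height l) k * codeWeight W l

/-- Summing out the labels of each step turns codes into Motzkin paths; `γ` collects the three kinds
of level step. The induction removes the last step and needs all end heights at once. -/
theorem sum_codeWeight (W : ℕ → Kind × ℕ → R) (U γ L : ℕ → R)
    (hU : ∀ h, ∑ a ∈ Finset.range (h + 1), W h (.cval, a) = U h)
    (hγ : ∀ h, (∑ a ∈ Finset.range h, W h (.cdrise, a)) +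
      ((∑ a ∈ Finset.range h, W h (.cdfall, a)) + W h (.fix, 0)) = γ h)
    (hL : ∀ h, ∑ a ∈ Finset.range (h + 1), W (h + 1) (.cpeak, a) = L h) (n : ℕ) :
    ∀ h : ℕ, ∑ l ∈ codes n, (if height l = h then codeWeight W l else 0) = motzkin U γ L n h := by
  induction n with
  | zero => intro h; cases h <;> simp [codes, height, motzkin, codeWeight]
  | succ n ih =>
    have aux : ∀ h m : ℕ, ∀ c : R, ∑ k ∈ steps m,
        (if stepHeight m k.1 = h then W m k * c else 0) =
        (if m + 1 = h then U m * c else 0) + γ h * (if m = h then c else 0) +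
        L h * (if m = h + 1 then c else 0) := by
      intro h m c
      rw [sum_steps]
      simp only [stepHeight]
      rw [← hγ, ← hU, ← hL]
      -- From height `0` a `cpeak` step would stay at `0` by truncation, but its label range is
      -- empty.
      cases m with
      | zero =>
        by_cases h0 : h = 0
        · subst h0; simp
        · by_cases h1 : h = 1
          · subst h1; simp
          · simp [Ne.symm h0, Ne.symm h1]
      | succ m =>
        rcases eq_or_ne h m with rfl | h0
        · simp [Finset.sum_mul, show h + 1 + 1 ≠ h by omega]
        rcases eq_or_ne h (m + 1) with rfl | h1
        · simp [Finset.sum_mul, add_mul]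
        rcases eq_or_ne h (m + 2) with rfl | h2
        · simp [Finset.sum_mul]
        · simp [Ne.symm h0, Ne.symm h1, Ne.symm h2]
    have key : ∀ h (l : List (Kind × ℕ)), ∑ k ∈ steps (height l),
        (if height (k :: l) = h then codeWeight W (k :: l) else 0) =
        (if height l + 1 = h then U (height l) * codeWeight W l else 0) +
        γ h * (if height l = h then codeWeight W l else 0) +
        L h * (if height l = h + 1 then codeWeight W l else 0) :=
      fun h l => aux h (height l) (codeWeight W l)
    intro h
    rw [sum_codes_succ, Finset.sum_congr rfl fun l _ => key h l, Finset.sum_add_distrib,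
      Finset.sum_add_distrib, ← Finset.mul_sum, ← Finset.mul_sum, ih, ih]
    cases h with
    | zero => simp [motzkin]
    | succ h =>
      rw [motzkin, ← ih h, Finset.mul_sum]
      congr 2
      refine Finset.sum_congr rfl fun l _ => ?_
      by_cases hl : height l = h <;> simp [hl]

end Weight

/-- With unit weights there are `h + 1` rises from `h`, `h + h + 1` level steps at `h` and `h + 1`
falls from `h + 1`: the recursion solved by `motzkin_choose`, here at end height `0`. -/
theorem card_codes (n : ℕ) : ((codes n).filter fun l => height l = 0).card = n.factorial := by
  have h := sum_codeWeight (R := ℤ) (fun _ _ => 1) (fun h => (h : ℤ) + 1)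
    (fun h => 2 * (h : ℤ) + 1) (fun h => (h : ℤ) + 1) (by simp)
    (by intro h; simp; ring) (by simp) n 0
  have hw : ∀ l, codeWeight (fun _ _ => (1 : ℤ)) l = 1 := by
    intro l
    induction l with
    | nil => rfl
    | cons k l ih => simp [codeWeight, ih]
  rw [motzkin_choose] at h
  simp only [hw, Finset.sum_boole, Nat.choose_zero_right] at h
  exact_mod_cast (by simpa using h)

end PermJFrac

/-! ### Inversion tables. -/

namespace PermJFrac

/-- A map is determined on a finite set by its image and its inversion table. -/
theorem eqOn_of_inversionTable {α β : Type*} [LinearOrder α] [LinearOrder β] (f g : α → β)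
    (S : Finset α) (hf : Set.InjOn f S) (hg : Set.InjOn g S) (himg : S.image f = S.image g)
    (h : ∀ j ∈ S, (S.filter fun i => i < j ∧ f j < f i).card =
      (S.filter fun i => i < j ∧ g j < g i).card) : Set.EqOn f g S := by
  induction S using Finset.induction_on_max with
  | empty => simp [Set.EqOn]
  | insert a S ha ih =>
    have haS : a ∉ S := fun h => lt_irrefl _ (ha a h)
    -- For the largest element `a` the condition `i < a` excludes only `a` itself, so its entry
    -- counts the values of the image above `φ a`.
    have card_eq : ∀ φ : α → β, Set.InjOn φ (insert a S : Finset α) →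
        ((insert a S).filter fun i => i < a ∧ φ a < φ i).card =
          (((insert a S).image φ).filter fun v => φ a < v).card := by
      intro φ hφ
      rw [Finset.filter_image, Finset.card_image_of_injOn]
      · congr 1
        ext i
        simp only [Finset.mem_filter, Finset.mem_insert]
        constructor
        · rintro ⟨hi, -, h⟩
          exact ⟨hi, h⟩
        · rintro ⟨rfl | hi, h⟩
          · exact absurd h (lt_irrefl _)
          · exact ⟨Or.inr hi, ha i hi, h⟩
      · exact hφ.mono (Finset.coe_subset.2 (Finset.filter_subset _ _))
    have hmem : ∀ φ : α → β, φ a ∈ (insert a S).image φ := fun φ =>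
      Finset.mem_image_of_mem _ (Finset.mem_insert_self _ _)
    -- This count is strictly decreasing along the image, hence determines `φ a`.
    have strict : ∀ (T : Finset β) (u v : β), v ∈ T → u < v →
        (T.filter fun x => v < x).card < (T.filter fun x => u < x).card := by
      intro T u v hv huv
      refine Finset.card_lt_card (Finset.ssubset_iff_of_subset ?_ |>.2 ⟨v, ?_, ?_⟩)
      · intro x hx
        rw [Finset.mem_filter] at hx ⊢
        exact ⟨hx.1, huv.trans hx.2⟩
      · simp [hv, huv]
      · simp
    have hfga : f a = g a := by
      have h0 := h a (Finset.mem_insert_self _ _)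
      rw [card_eq f hf, card_eq g hg, himg] at h0
      rcases lt_trichotomy (f a) (g a) with hlt | heq | hlt
      · exact absurd h0 (strict _ _ _ (hmem g) hlt).ne'
      · exact heq
      · exact absurd h0 (strict _ _ _ (himg ▸ hmem f) hlt).ne
    have sub : (S : Set α) ⊆ (insert a S : Finset α) := by
      simp
    have img : ∀ φ : α → β, Set.InjOn φ (insert a S : Finset α) →
        S.image φ = ((insert a S).image φ).erase (φ a) := by
      intro φ hφ
      rw [Finset.image_insert, Finset.erase_insert]
      intro hmem
      obtain ⟨b, hb, hba⟩ := Finset.mem_image.1 hmem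
      exact haS (hφ (sub hb) (by simp) hba ▸ hb)
    have hS := ih (hf.mono sub) (hg.mono sub) (by rw [img f hf, img g hg, himg, hfga]) (by
      intro j hj
      have h0 := h j (Finset.mem_insert_of_mem hj)
      rwa [Finset.filter_insert, Finset.filter_insert, if_neg, if_neg] at h0
      · exact fun h => (ha j hj).not_gt h.1
      · exact fun h => (ha j hj).not_gt h.1)
    intro x hx
    rcases Finset.mem_insert.1 hx with rfl | hx
    · exact hfga
    · exact hS hx

theorem eqOn_of_inversionTable_dual {α β : Type*} [LinearOrder α] [LinearOrder β] (f g : α → β)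
    (S : Finset α) (hf : Set.InjOn f S) (hg : Set.InjOn g S) (himg : S.image f = S.image g)
    (h : ∀ j ∈ S, (S.filter fun i => j < i ∧ f i < f j).card =
      (S.filter fun i => j < i ∧ g i < g j).card) : Set.EqOn f g S :=
  eqOn_of_inversionTable (α := αᵒᵈ) (β := βᵒᵈ) f g S hf hg himg h

/-! ### Cyclic types and ranks determine the permutation. -/

section Perm

variable {n : ℕ}

/-- The cyclic type of an index. -/
def kind (σ : Equiv.Perm (Fin n)) (i : Fin n) : Kind :=
  if σ i = i then .fix
  else if i < σ i then (if σ.symm i < i then .cdrise else .cval)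
  else (if σ.symm i < i then .cpeak else .cdfall)

/-- The number of upper or lower nestings attributed to an index. -/
def rank (σ : Equiv.Perm (Fin n)) (i : Fin n) : ℕ :=
  if σ i = i then 0
  else if i < σ i then countIdx fun j => j < i ∧ σ i < σ j
  else countIdx fun j => i < j ∧ σ j < σ i

theorem symm_ne {σ : Equiv.Perm (Fin n)} {i : Fin n} (h : σ i ≠ i) : σ.symm i ≠ i :=
  fun h' => h (by conv_lhs => rw [← h', Equiv.apply_symm_apply])

theorem lt_apply_iff {σ : Equiv.Perm (Fin n)} {i : Fin n} :
    i < σ i ↔ kind σ i = .cval ∨ kind σ i = .cdrise := by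
  unfold kind
  split_ifs <;> simp_all

theorem apply_lt_iff {σ : Equiv.Perm (Fin n)} {i : Fin n} :
    σ i < i ↔ kind σ i = .cpeak ∨ kind σ i = .cdfall := by
  unfold kind
  split_ifs with h1 h2
  · simp [h1]
  · simp [h2.le]
  · simp [h2.le]
  · simpa using lt_of_le_of_ne (not_lt.1 h2) h1
  · simpa using lt_of_le_of_ne (not_lt.1 h2) h1

theorem symm_lt_iff {σ : Equiv.Perm (Fin n)} {i : Fin n} :
    σ.symm i < i ↔ kind σ i = .cpeak ∨ kind σ i = .cdrise := by
  by_cases h : σ i = i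
  · simp [kind, h, (Equiv.symm_apply_eq σ).2 h.symm]
  · unfold kind
    split_ifs <;> simp_all

theorem lt_symm_iff {σ : Equiv.Perm (Fin n)} {i : Fin n} :
    i < σ.symm i ↔ kind σ i = .cval ∨ kind σ i = .cdfall := by
  by_cases h : σ i = i
  · simp [kind, h, (Equiv.symm_apply_eq σ).2 h.symm]
  · have := symm_ne h
    unfold kind
    split_ifs with h1 h2 <;> simp_all [le_of_lt, lt_iff_le_and_ne, Ne.symm]

theorem apply_eq_iff {σ : Equiv.Perm (Fin n)} {i : Fin n} :
    σ i = i ↔ kind σ i = .fix := by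
  unfold kind
  split_ifs <;> simp_all

theorem rank_of_lt {σ : Equiv.Perm (Fin n)} {i : Fin n} (h : i < σ i) :
    rank σ i = countIdx fun j => j < i ∧ σ i < σ j := by
  rw [rank, if_neg h.ne', if_pos h]

theorem rank_of_gt {σ : Equiv.Perm (Fin n)} {i : Fin n} (h : σ i < i) :
    rank σ i = countIdx fun j => i < j ∧ σ j < σ i := by
  rw [rank, if_neg h.ne, if_neg h.not_gt]

theorem rank_of_eq {σ : Equiv.Perm (Fin n)} {i : Fin n} (h : σ i = i) : rank σ i = 0 := by
  rw [rank, if_pos h]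

/-- A permutation is determined by the types and the nesting numbers of its indices. -/
theorem eq_of_kind_rank {σ τ : Equiv.Perm (Fin n)} (hk : ∀ i, kind σ i = kind τ i)
    (hr : ∀ i, rank σ i = rank τ i) : σ = τ := by
  have up : ∀ i, i < σ i ↔ i < τ i := fun i => by rw [lt_apply_iff, lt_apply_iff, hk]
  have down : ∀ i, σ i < i ↔ τ i < i := fun i => by rw [apply_lt_iff, apply_lt_iff, hk]
  have hup : Set.EqOn σ τ (Finset.univ.filter fun i => i < σ i) := by
    refine eqOn_of_inversionTable σ τ _ σ.injective.injOn τ.injective.injOn ?_ ?_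
    · ext v
      -- The image of the excedances is the set of `v` whose preimage is smaller, which the types
      -- record.
      have hσ : v ∈ (Finset.univ.filter fun i => i < σ i).image σ ↔ σ.symm v < v := by
        simp only [Finset.mem_image, Finset.mem_filter, Finset.mem_univ, true_and]
        exact ⟨by rintro ⟨i, hi, rfl⟩; simpa using hi, fun h => ⟨σ.symm v, by simpa using h, by simp⟩⟩
      have hτ : v ∈ (Finset.univ.filter fun i => i < σ i).image τ ↔ τ.symm v < v := by
        simp only [Finset.mem_image, Finset.mem_filter, Finset.mem_univ, true_and, up]
        exact ⟨by rintro ⟨i, hi, rfl⟩; simpa using hi, fun h => ⟨τ.symm v, by simpa using h, by simp⟩⟩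
      rw [hσ, hτ, symm_lt_iff, symm_lt_iff, hk]
    · intro j hj
      have hj' : j < σ j := by simpa using hj
      have h := hr j
      rw [rank_of_lt hj', rank_of_lt ((up j).1 hj'), countIdx, countIdx] at h
      -- Restricting to excedances loses nothing: `i < j < σ j < σ i` forces `i < σ i`.
      convert h using 2
      · ext i
        simp only [Finset.mem_filter, Finset.mem_univ, true_and]
        exact ⟨fun h => h.2, fun h => ⟨h.1.trans (hj'.trans h.2), h⟩⟩
      · ext i
        simp only [Finset.mem_filter, Finset.mem_univ, true_and]
        exact ⟨fun h => h.2, fun h => ⟨(up i).2 (h.1.trans (((up j).1 hj').trans h.2)), h⟩⟩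
  have hdown : Set.EqOn σ τ (Finset.univ.filter fun i => σ i < i) := by
    refine eqOn_of_inversionTable_dual σ τ _ σ.injective.injOn τ.injective.injOn ?_ ?_
    · ext v
      have hσ : v ∈ (Finset.univ.filter fun i => σ i < i).image σ ↔ v < σ.symm v := by
        simp only [Finset.mem_image, Finset.mem_filter, Finset.mem_univ, true_and]
        exact ⟨by rintro ⟨i, hi, rfl⟩; simpa using hi, fun h => ⟨σ.symm v, by simpa using h, by simp⟩⟩
      have hτ : v ∈ (Finset.univ.filter fun i => σ i < i).image τ ↔ v < τ.symm v := by
        simp only [Finset.mem_image, Finset.mem_filter, Finset.mem_univ, true_and, down]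
        exact ⟨by rintro ⟨i, hi, rfl⟩; simpa using hi, fun h => ⟨τ.symm v, by simpa using h, by simp⟩⟩
      rw [hσ, hτ, lt_symm_iff, lt_symm_iff, hk]
    · intro j hj
      have hj' : σ j < j := (Finset.mem_filter.1 hj).2
      have h := hr j
      rw [rank_of_gt hj', rank_of_gt ((down j).1 hj'), countIdx, countIdx] at h
      convert h using 2
      · ext i
        simp only [Finset.mem_filter, Finset.mem_univ, true_and]
        exact ⟨fun h => h.2, fun h => ⟨(h.2.trans hj').trans h.1, h⟩⟩
      · ext i
        simp only [Finset.mem_filter, Finset.mem_univ, true_and]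
        exact ⟨fun h => h.2, fun h => ⟨(down i).2 ((h.2.trans ((down j).1 hj')).trans h.1), h⟩⟩
  ext1 i
  rcases lt_trichotomy i (σ i) with h | h | h
  · exact hup (by simpa using h)
  · rw [← h]
    have := apply_eq_iff.1 h.symm
    rw [hk] at this
    exact (apply_eq_iff.2 this).symm
  · exact hdown (by simpa using h)

/-! ### Heights -/

/-- The number of arcs from `[0, m)` to `[m, n)`. -/
def openCount (σ : Equiv.Perm (Fin n)) (m : ℕ) : ℕ :=
  countIdx fun j => (j : ℕ) < m ∧ m ≤ (σ j : ℕ)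

theorem card_filter_or_eq {α : Type*} [Fintype α] [DecidableEq α] (P : α → Prop) [DecidablePred P]
    (a : α) (c : Prop) [Decidable c] (hP : ¬ P a) :
    (Finset.univ.filter fun x => P x ∨ (x = a ∧ c)).card =
      (Finset.univ.filter P).card + if c then 1 else 0 := by
  rw [Finset.filter_or, Finset.card_union_of_disjoint]
  · by_cases hc : c <;> simp [hc, Finset.filter_eq']
  · rw [Finset.disjoint_filter]
    rintro x - hx ⟨rfl, -⟩
    exact hP hx

/-- An arc counted by the height before `i` either passes over `i` or ends at `i`. In the companion
`openCount_succ` it passes over `i` or starts at `i`. -/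
theorem openCount_eq (σ : Equiv.Perm (Fin n)) (i : Fin n) :
    openCount σ i = lev i σ + if σ.symm i < i then 1 else 0 := by
  rw [openCount, lev, countIdx, countIdx, ← card_filter_or_eq _ (σ.symm i) _ (by simp)]
  congr 1
  ext j
  simp only [Finset.mem_filter, Finset.mem_univ, true_and, Fin.val_fin_lt, Fin.val_fin_le]
  constructor
  · rintro ⟨h1, h2⟩
    rcases h2.lt_or_eq with h2 | h2
    · exact Or.inl ⟨h1, h2⟩
    · have := (Equiv.eq_symm_apply σ).2 h2.symm
      exact Or.inr ⟨this, this ▸ h1⟩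
  · rintro (⟨h1, h2⟩ | ⟨rfl, h⟩)
    · exact ⟨h1, h2.le⟩
    · exact ⟨h, by simp⟩

theorem openCount_succ (σ : Equiv.Perm (Fin n)) (i : Fin n) :
    openCount σ (i + 1) = lev i σ + if i < σ i then 1 else 0 := by
  rw [openCount, lev, countIdx, countIdx, ← card_filter_or_eq _ i _ (by simp)]
  congr 1
  ext j
  simp only [Finset.mem_filter, Finset.mem_univ, true_and, Nat.lt_succ_iff, Nat.succ_le_iff,
    Fin.val_fin_lt, Fin.val_fin_le]
  constructor
  · rintro ⟨h1, h2⟩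
    rcases h1.lt_or_eq with h1 | rfl
    · exact Or.inl ⟨h1, h2⟩
    · exact Or.inr ⟨rfl, h2⟩
  · rintro (⟨h1, h2⟩ | ⟨rfl, h⟩)
    · exact ⟨h1.le, h2⟩
    · exact ⟨le_rfl, h⟩

theorem openCount_zero (σ : Equiv.Perm (Fin n)) : openCount σ 0 = 0 := by
  simp [openCount, countIdx]

theorem openCount_self (σ : Equiv.Perm (Fin n)) : openCount σ n = 0 := by
  simp [openCount, countIdx]

/-- As many arcs leave `[0, i)` as enter it. -/
theorem openCount_eq_card (σ : Equiv.Perm (Fin n)) (i : Fin n) :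
    openCount σ i = countIdx fun j => i ≤ j ∧ σ j < i := by
  -- The sets `{j < i}` and `{σ j < i}` have equal size; removing their intersection leaves the two
  -- sets to be compared.
  have h1 : (Finset.univ.filter fun j => j < i).card = (Finset.univ.filter fun j => σ j < i).card :=
    Finset.card_bij' (fun j _ => σ.symm j) (fun j _ => σ j) (by simp) (by simp) (by simp) (by simp)
  have h2 := Finset.card_filter_add_card_filter_not (s := Finset.univ.filter fun j => j < i)
    (fun j => σ j < i)
  have h3 := Finset.card_filter_add_card_filter_not (s := Finset.univ.filter fun j => σ j < i)
    (fun j => j < i)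
  simp only [Finset.filter_filter, not_lt] at h2 h3
  simp only [openCount, countIdx, Fin.val_fin_lt, Fin.val_fin_le]
  have e1 : (Finset.univ.filter fun j => σ j < i ∧ j < i) =
    Finset.univ.filter fun j => j < i ∧ σ j < i := by ext; simp [and_comm]
  have e2 : (Finset.univ.filter fun j => σ j < i ∧ i ≤ j) =
    Finset.univ.filter fun j => i ≤ j ∧ σ j < i := by ext; simp [and_comm]
  rw [e1, e2] at h3
  omega

/-- The number of crossings attributed to `i`. -/
def cross (σ : Equiv.Perm (Fin n)) (i : Fin n) : ℕ :=
  if i < σ i then countIdx fun j => j < i ∧ i < σ j ∧ σ j < σ i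
  else countIdx fun j => i < j ∧ σ j < i ∧ σ i < σ j

theorem cross_of_lt {σ : Equiv.Perm (Fin n)} {i : Fin n} (h : i < σ i) :
    cross σ i = countIdx fun j => j < i ∧ i < σ j ∧ σ j < σ i := if_pos h

theorem cross_of_gt {σ : Equiv.Perm (Fin n)} {i : Fin n} (h : σ i < i) :
    cross σ i = countIdx fun j => i < j ∧ σ j < i ∧ σ i < σ j := if_neg h.not_gt

/-- An arc passing over `i` crosses the arc from `i` or encloses it, according to whether it ends
before or after `σ i`. -/
theorem cross_add_rank_of_lt {σ : Equiv.Perm (Fin n)} {i : Fin n} (h : i < σ i) :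
    cross σ i + rank σ i = lev i σ := by
  rw [cross_of_lt h, rank_of_lt h, lev, countIdx, countIdx, countIdx,
    ← Finset.card_union_of_disjoint]
  · congr 1
    ext j
    simp only [Finset.mem_union, Finset.mem_filter, Finset.mem_univ, true_and]
    constructor
    · rintro (h' | h')
      · exact ⟨h'.1, h'.2.1⟩
      · exact ⟨h'.1, h.trans h'.2⟩
    · rintro ⟨h1, h2⟩
      rcases lt_trichotomy (σ j) (σ i) with h3 | h3 | h3
      · exact Or.inl ⟨h1, h2, h3⟩
      · exact absurd (σ.injective h3) h1.ne
      · exact Or.inr ⟨h1, h3⟩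
  · rw [Finset.disjoint_filter]
    rintro j - h1 h2
    exact h2.2.not_gt h1.2.2

/-- The downward arcs counted by `openCount_eq_card` include the arc from `i` itself, hence the `+
1`. -/
theorem cross_add_rank_of_gt {σ : Equiv.Perm (Fin n)} {i : Fin n} (h : σ i < i) :
    cross σ i + rank σ i + 1 = openCount σ i := by
  have h0 : (countIdx fun j => i < j ∧ σ j < i) + 1 = countIdx fun j => i ≤ j ∧ σ j < i := by
    have := card_filter_or_eq (fun j => i < j ∧ σ j < i) i True (by simp)
    rw [if_pos trivial] at this
    rw [countIdx, countIdx, ← this]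
    congr 1
    ext j
    simp only [Finset.mem_filter, Finset.mem_univ, true_and, and_true]
    constructor
    · rintro (h' | rfl)
      · exact ⟨h'.1.le, h'.2⟩
      · exact ⟨le_rfl, h⟩
    · rintro ⟨h1, h2⟩
      rcases h1.lt_or_eq with h1 | h1
      · exact Or.inl ⟨h1, h2⟩
      · exact Or.inr h1.symm
  rw [openCount_eq_card, ← h0, cross_of_gt h, rank_of_gt h, countIdx, countIdx, countIdx,
    ← Finset.card_union_of_disjoint]
  · congr 2
    ext j
    simp only [Finset.mem_union, Finset.mem_filter, Finset.mem_univ, true_and]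
    constructor
    · rintro (h' | h')
      · exact ⟨h'.1, h'.2.1⟩
      · exact ⟨h'.1, h'.2.trans h⟩
    · rintro ⟨h1, h2⟩
      rcases lt_trichotomy (σ j) (σ i) with h3 | h3 | h3
      · exact Or.inr ⟨h1, h3⟩
      · exact absurd (σ.injective h3) h1.ne'
      · exact Or.inl ⟨h1, h2, h3⟩
  · rw [Finset.disjoint_filter]
    rintro j - h1 h2
    exact h2.2.not_gt h1.2.2

theorem openCount_succ_eq_stepHeight (σ : Equiv.Perm (Fin n)) (i : Fin n) :
    openCount σ (i + 1) = stepHeight (openCount σ i) (kind σ i) := by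
  rw [openCount_eq, openCount_succ]
  have h1 := lt_apply_iff (σ := σ) (i := i)
  have h2 := symm_lt_iff (σ := σ) (i := i)
  cases hk : kind σ i <;> simp only [hk, reduceCtorEq, or_false, or_true, iff_true, iff_false,
    or_self] at h1 h2 <;> simp [h1, h2, stepHeight]

/-- The rank is bounded by crossings plus nestings: this sum is the height for `cval`, and one less
for the other three nonfixed types, where an arc arriving at or leaving `i` is discounted. -/
theorem rank_lt_labels (σ : Equiv.Perm (Fin n)) (i : Fin n) :
    rank σ i < labels (openCount σ i) (kind σ i) := by
  have h1 := lt_apply_iff (σ := σ) (i := i)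
  have h2 := symm_lt_iff (σ := σ) (i := i)
  have h3 := apply_lt_iff (σ := σ) (i := i)
  have h4 := openCount_eq σ i
  have h5 := cross_add_rank_of_lt (σ := σ) (i := i)
  have h6 := cross_add_rank_of_gt (σ := σ) (i := i)
  cases hk : kind σ i <;> simp only [hk, reduceCtorEq, or_false, or_true, iff_true, iff_false,
    or_self] at h1 h2 h3 <;>
    simp only [labels]
  · rw [if_neg h2] at h4; have := h5 h1; omega
  · rw [if_pos h2] at h4; have := h5 h1; omega
  · have := h6 h3; omega
  · have := h6 h3; omega
  · rw [rank_of_eq (apply_eq_iff.2 hk)]; exact Nat.one_pos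

/-! ### The code of a permutation -/

/-- The code of the restriction of `σ` to `[0, m)`. -/
def prefixCode (σ : Equiv.Perm (Fin n)) : ℕ → List (Kind × ℕ)
  | 0 => []
  -- The default `(.fix, 0)` never occurs for prefixes of length at most `n`.
  | m + 1 => (if h : m < n then (kind σ ⟨m, h⟩, rank σ ⟨m, h⟩) else (.fix, 0)) :: prefixCode σ m

theorem prefixCode_succ (σ : Equiv.Perm (Fin n)) {m : ℕ} (h : m < n) :
    prefixCode σ (m + 1) = (kind σ ⟨m, h⟩, rank σ ⟨m, h⟩) :: prefixCode σ m := by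
  rw [prefixCode, dif_pos h]

theorem height_prefixCode (σ : Equiv.Perm (Fin n)) :
    ∀ m ≤ n, height (prefixCode σ m) = openCount σ m
  | 0, _ => (openCount_zero σ).symm
  | m + 1, h => by
      rw [prefixCode_succ σ h, height, height_prefixCode σ m (by omega)]
      exact (openCount_succ_eq_stepHeight σ ⟨m, h⟩).symm

theorem prefixCode_mem (σ : Equiv.Perm (Fin n)) : ∀ m ≤ n, prefixCode σ m ∈ codes m
  | 0, _ => by simp [prefixCode, codes]
  | m + 1, h => by
      rw [prefixCode_succ σ h, cons_mem_codes, height_prefixCode σ m (by omega)]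
      exact ⟨prefixCode_mem σ m (by omega), rank_lt_labels σ ⟨m, h⟩⟩

theorem codeWeight_prefixCode {R : Type*} [CommRing R] (W : ℕ → Kind × ℕ → R)
    (σ : Equiv.Perm (Fin n)) : codeWeight W (prefixCode σ n) =
      ∏ i : Fin n, W (openCount σ i) (kind σ i, rank σ i) := by
  have key : ∀ m ≤ n, codeWeight W (prefixCode σ m) = ∏ i ∈ Finset.range m,
      if h : i < n then W (openCount σ i) (kind σ ⟨i, h⟩, rank σ ⟨i, h⟩) else 1 := by
    intro m
    induction m with
    | zero => intro _; rfl
    | succ m ih =>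
      intro h
      rw [prefixCode_succ σ h, codeWeight, ih (by omega), Finset.prod_range_succ,
        dif_pos (Nat.lt_of_succ_le h), height_prefixCode σ m (by omega), mul_comm]
  rw [key n le_rfl, Finset.prod_range]
  exact Finset.prod_congr rfl fun i _ => dif_pos i.2

theorem prefixCode_injective : Function.Injective fun σ : Equiv.Perm (Fin n) => prefixCode σ n := by
  intro σ τ h
  have key : ∀ m ≤ n, prefixCode σ m = prefixCode τ m → ∀ i : Fin n, (i : ℕ) < m →
      kind σ i = kind τ i ∧ rank σ i = rank τ i := by
    intro m
    induction m with
    | zero => intro _ _ i hi; exact absurd hi (Nat.not_lt_zero _)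
    | succ m ih =>
      intro hm heq i hi
      rw [prefixCode_succ σ hm, prefixCode_succ τ hm, List.cons.injEq, Prod.mk.injEq] at heq
      rcases Nat.lt_succ_iff_lt_or_eq.1 hi with hi | hi
      · exact ih (by omega) heq.2 i hi
      · obtain rfl : i = ⟨m, hm⟩ := Fin.ext hi
        exact heq.1
  exact eq_of_kind_rank (fun i => (key n le_rfl h i i.2).1) fun i => (key n le_rfl h i i.2).2

/-- The codes of the permutations are the closed labelled Motzkin paths. -/
theorem image_prefixCode : (Finset.univ.image fun σ : Equiv.Perm (Fin n) => prefixCode σ n) =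
    (codes n).filter fun l => height l = 0 := by
  refine Finset.eq_of_subset_of_card_le ?_ ?_
  · intro l hl
    obtain ⟨σ, -, rfl⟩ := Finset.mem_image.1 hl
    rw [Finset.mem_filter]
    exact ⟨prefixCode_mem σ n le_rfl, (height_prefixCode σ n le_rfl).trans (openCount_self σ)⟩
  -- Surjectivity by counting: `n!` distinct codes lie in a set of size `n!`.
  · rw [card_codes, Finset.card_image_of_injective _ prefixCode_injective, Finset.card_univ,
      Fintype.card_perm, Fintype.card_fin]

theorem sum_perm_eq_sum_codes {R : Type*} [CommRing R] (W : ℕ → Kind × ℕ → R) :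
    ∑ σ : Equiv.Perm (Fin n), ∏ i : Fin n, W (openCount σ i) (kind σ i, rank σ i) =
      ∑ l ∈ codes n, if height l = 0 then codeWeight W l else 0 := by
  rw [← Finset.sum_filter, ← image_prefixCode,
    Finset.sum_image fun _ _ _ _ h => prefixCode_injective h]
  exact Finset.sum_congr rfl fun σ _ => (codeWeight_prefixCode W σ).symm

end Perm

end PermJFrac

namespace PermJFrac

variable {n : ℕ}

/-! ### Records -/

/-- Otherwise `σ` would inject the indices above `i` into the strictly smaller set of values above
`σ i`. -/
theorem not_isArec_of_lt {σ : Equiv.Perm (Fin n)} {i : Fin n} (h : i < σ i) : ¬ IsArec σ i := by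
  intro ha
  have := Finset.card_le_card_of_injOn (s := Finset.Ioi i) (t := Finset.Ioi (σ i)) σ
    (fun j hj => by simpa using ha j (by simpa using hj)) σ.injective.injOn
  rw [Fin.card_Ioi, Fin.card_Ioi] at this
  have := (σ i).2
  have := Fin.lt_def.1 h
  omega

theorem not_isRec_of_gt {σ : Equiv.Perm (Fin n)} {i : Fin n} (h : σ i < i) : ¬ IsRec σ i := by
  intro ha
  have := Finset.card_le_card_of_injOn (s := Finset.Iio i) (t := Finset.Iio (σ i)) σ
    (fun j hj => by simpa using ha j (by simpa using hj)) σ.injective.injOn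
  rw [Fin.card_Iio, Fin.card_Iio] at this
  exact absurd h (by simpa using this)

theorem isRec_iff_of_lt {σ : Equiv.Perm (Fin n)} {i : Fin n} (h : i < σ i) :
    IsRec σ i ↔ rank σ i = 0 := by
  rw [rank_of_lt h, countIdx, Finset.card_eq_zero, Finset.filter_eq_empty_iff]
  constructor
  · exact fun hr j _ hj => (hr j hj.1).not_gt hj.2
  · exact fun hr j hj => lt_of_le_of_ne (not_lt.1 fun h' => hr (Finset.mem_univ j) ⟨hj, h'⟩)
      fun h' => hj.ne (σ.injective h')

theorem isArec_iff_of_gt {σ : Equiv.Perm (Fin n)} {i : Fin n} (h : σ i < i) :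
    IsArec σ i ↔ rank σ i = 0 := by
  rw [rank_of_gt h, countIdx, Finset.card_eq_zero, Finset.filter_eq_empty_iff]
  constructor
  · exact fun hr j _ hj => (hr j hj.1).not_gt hj.2
  · exact fun hr j hj => lt_of_le_of_ne (not_lt.1 fun h' => hr (Finset.mem_univ j) ⟨hj, h'⟩)
      fun h' => hj.ne (σ.injective h')

theorem isCval_iff {σ : Equiv.Perm (Fin n)} {i : Fin n} : IsCval σ i ↔ kind σ i = .cval := by
  rw [IsCval, lt_symm_iff, lt_apply_iff]
  cases kind σ i <;> simp

theorem isCdrise_iff {σ : Equiv.Perm (Fin n)} {i : Fin n} : IsCdrise σ i ↔ kind σ i = .cdrise := by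
  rw [IsCdrise, symm_lt_iff, lt_apply_iff]
  cases kind σ i <;> simp

theorem isCpeak_iff {σ : Equiv.Perm (Fin n)} {i : Fin n} : IsCpeak σ i ↔ kind σ i = .cpeak := by
  rw [IsCpeak, symm_lt_iff, apply_lt_iff]
  cases kind σ i <;> simp

theorem isCdfall_iff {σ : Equiv.Perm (Fin n)} {i : Fin n} : IsCdfall σ i ↔ kind σ i = .cdfall := by
  rw [IsCdfall, lt_symm_iff, apply_lt_iff]
  cases kind σ i <;> simp

/-- Here `C` stands for a cycle type of excedances: these are never antirecords, so exclusivity is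
automatic, and the rank counts the obstructions to being a record. -/
theorem isErec_and_iff {σ : Equiv.Perm (Fin n)} {i : Fin n} {C : Prop} (h : C → i < σ i) :
    IsErec σ i ∧ C ↔ C ∧ rank σ i = 0 := by
  rw [and_comm]
  refine and_congr_right fun hC => ?_
  rw [IsErec, isRec_iff_of_lt (h hC), and_iff_left (not_isArec_of_lt (h hC))]

theorem isNrar_and_iff_of_lt {σ : Equiv.Perm (Fin n)} {i : Fin n} {C : Prop} (h : C → i < σ i) :
    IsNrar σ i ∧ C ↔ C ∧ rank σ i ≠ 0 := by
  rw [and_comm]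
  refine and_congr_right fun hC => ?_
  rw [IsNrar, isRec_iff_of_lt (h hC), and_iff_left (not_isArec_of_lt (h hC))]

theorem isEarec_and_iff {σ : Equiv.Perm (Fin n)} {i : Fin n} {C : Prop} (h : C → σ i < i) :
    IsEarec σ i ∧ C ↔ C ∧ rank σ i = 0 := by
  rw [and_comm]
  refine and_congr_right fun hC => ?_
  rw [IsEarec, isArec_iff_of_gt (h hC), and_iff_left (not_isRec_of_gt (h hC))]

theorem isNrar_and_iff_of_gt {σ : Equiv.Perm (Fin n)} {i : Fin n} {C : Prop} (h : C → σ i < i) :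
    IsNrar σ i ∧ C ↔ C ∧ rank σ i ≠ 0 := by
  rw [and_comm]
  refine and_congr_right fun hC => ?_
  rw [IsNrar, isArec_iff_of_gt (h hC), and_iff_right (not_isRec_of_gt (h hC))]

/-- As a sum over indices, a statistic in an exponent becomes a product over indices. -/
theorem countIdx_eq_sum {P P' : Fin n → Prop} [DecidablePred P] [DecidablePred P']
    (h : ∀ i, P i ↔ P' i) : countIdx P = ∑ i, if P' i then 1 else 0 := by
  rw [countIdx, Finset.card_filter]
  exact Finset.sum_congr rfl fun i _ => if_congr (h i) rfl rfl

theorem ereccval_eq (σ : Equiv.Perm (Fin n)) :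
    ereccval σ = ∑ i, if kind σ i = .cval ∧ rank σ i = 0 then 1 else 0 :=
  countIdx_eq_sum fun i => by rw [isErec_and_iff fun h => h.2, isCval_iff]

theorem ereccdrise_eq (σ : Equiv.Perm (Fin n)) :
    ereccdrise σ = ∑ i, if kind σ i = .cdrise ∧ rank σ i = 0 then 1 else 0 :=
  countIdx_eq_sum fun i => by rw [isErec_and_iff fun h => h.2, isCdrise_iff]

theorem eareccpeak_eq (σ : Equiv.Perm (Fin n)) :
    eareccpeak σ = ∑ i, if kind σ i = .cpeak ∧ rank σ i = 0 then 1 else 0 :=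
  countIdx_eq_sum fun i => by rw [isEarec_and_iff fun h => h.2, isCpeak_iff]

theorem eareccdfall_eq (σ : Equiv.Perm (Fin n)) :
    eareccdfall σ = ∑ i, if kind σ i = .cdfall ∧ rank σ i = 0 then 1 else 0 :=
  countIdx_eq_sum fun i => by rw [isEarec_and_iff fun h => h.2, isCdfall_iff]

theorem nrcval_eq (σ : Equiv.Perm (Fin n)) :
    nrcval σ = ∑ i, if kind σ i = .cval ∧ rank σ i ≠ 0 then 1 else 0 :=
  countIdx_eq_sum fun i => by rw [isNrar_and_iff_of_lt fun h => h.2, isCval_iff]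

theorem nrcdrise_eq (σ : Equiv.Perm (Fin n)) :
    nrcdrise σ = ∑ i, if kind σ i = .cdrise ∧ rank σ i ≠ 0 then 1 else 0 :=
  countIdx_eq_sum fun i => by rw [isNrar_and_iff_of_lt fun h => h.2, isCdrise_iff]

theorem nrcpeak_eq (σ : Equiv.Perm (Fin n)) :
    nrcpeak σ = ∑ i, if kind σ i = .cpeak ∧ rank σ i ≠ 0 then 1 else 0 :=
  countIdx_eq_sum fun i => by rw [isNrar_and_iff_of_gt fun h => h.2, isCpeak_iff]

theorem nrcdfall_eq (σ : Equiv.Perm (Fin n)) :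
    nrcdfall σ = ∑ i, if kind σ i = .cdfall ∧ rank σ i ≠ 0 then 1 else 0 :=
  countIdx_eq_sum fun i => by rw [isNrar_and_iff_of_gt fun h => h.2, isCdfall_iff]

/-! ### Crossings and nestings -/

/-- Two free coordinates determine a tuple satisfying `P`; the count is split by the index `b a` to
which the tuple is charged. -/
theorem card_filter_eq_sum_card {α β γ : Type*} [Fintype α] [Fintype β] [Fintype γ]
    (P : α → Prop) [DecidablePred P] (e : β → γ → α) (b : α → β) (c : α → γ)
    (h : ∀ a, P a → e (b a) (c a) = a) (hb : ∀ x y, b (e x y) = x) (hc : ∀ x y, c (e x y) = y) :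
    (Finset.univ.filter P).card = ∑ x, (Finset.univ.filter fun y => P (e x y)).card := by
  rw [← Finset.card_sigma]
  refine Finset.card_bij' (fun a _ => ⟨b a, c a⟩) (fun z _ => e z.1 z.2) ?_ ?_ ?_ ?_
  · intro a ha
    have ha' := (Finset.mem_filter.1 ha).2
    simpa [h a ha'] using ha'
  · intro z hz
    simpa using hz
  · intro a ha
    exact h a (Finset.mem_filter.1 ha).2
  · rintro ⟨x, y⟩ -
    simp [hb, hc]

theorem card_filter_eq_ite {α : Type*} [Fintype α] {P P' : α → Prop} [DecidablePred P]
    [DecidablePred P'] {C : Prop} [Decidable C] (h : ∀ y, P y ↔ C ∧ P' y) :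
    (Finset.univ.filter P).card = if C then (Finset.univ.filter P').card else 0 := by
  split_ifs with hC
  · congr 1
    ext y
    simp [h, hC]
  · simp [h, hC]

/-- The sources `i < j` determine the quadruplet, which is charged to `j`; `C` is the side condition
giving the type. Lower patterns are charged to `k` instead. -/
theorem upper_crossings_eq (σ : Equiv.Perm (Fin n)) (C : Fin n → Prop) [DecidablePred C] :
    (countQuad fun i j k l => k = σ i ∧ l = σ j ∧ C j) =
      ∑ j, if j < σ j ∧ C j then cross σ j else 0 := by
  rw [countQuad, card_filter_eq_sum_card (β := Fin n) (γ := Fin n) _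
    (fun x y => (y, x, σ y, σ x)) (fun a => a.2.1) (fun a => a.1)
    (by rintro ⟨i, j, k, l⟩ ⟨-, -, -, h, h', -⟩
        simp only at h h'
        rw [← h, ← h']) (fun _ _ => rfl) (fun _ _ => rfl)]
  refine Finset.sum_congr rfl fun j _ => ?_
  rw [card_filter_eq_ite (C := j < σ j ∧ C j) (P' := fun i => i < j ∧ j < σ i ∧ σ i < σ j)]
  · exact ite_congr rfl (fun h => (cross_of_lt h.1).symm) fun _ => rfl
  · intro i
    constructor
    · rintro ⟨h1, h2, h3, -, -, h⟩
      exact ⟨⟨h2.trans h3, h⟩, h1, h2, h3⟩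
    · rintro ⟨⟨-, h⟩, h1, h2, h3⟩
      exact ⟨h1, h2, h3, rfl, rfl, h⟩

theorem upper_nestings_eq (σ : Equiv.Perm (Fin n)) (C : Fin n → Prop) [DecidablePred C] :
    (countQuad fun i j k l => l = σ i ∧ k = σ j ∧ C j) =
      ∑ j, if j < σ j ∧ C j then rank σ j else 0 := by
  rw [countQuad, card_filter_eq_sum_card (β := Fin n) (γ := Fin n) _
    (fun x y => (y, x, σ x, σ y)) (fun a => a.2.1) (fun a => a.1)
    (by rintro ⟨i, j, k, l⟩ ⟨-, -, -, h, h', -⟩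
        simp only at h h'
        rw [← h, ← h']) (fun _ _ => rfl) (fun _ _ => rfl)]
  refine Finset.sum_congr rfl fun j _ => ?_
  rw [card_filter_eq_ite (C := j < σ j ∧ C j) (P' := fun i => i < j ∧ σ j < σ i)]
  · exact ite_congr rfl (fun h => (rank_of_lt h.1).symm) fun _ => rfl
  · intro i
    constructor
    · rintro ⟨h1, h2, h3, -, -, h⟩
      exact ⟨⟨h2, h⟩, h1, h3⟩
    · rintro ⟨⟨h2, h⟩, h1, h3⟩
      exact ⟨h1, h2, h3, rfl, rfl, h⟩

theorem lower_crossings_eq (σ : Equiv.Perm (Fin n)) (C : Fin n → Prop) [DecidablePred C] :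
    (countQuad fun i j k l => i = σ k ∧ j = σ l ∧ C k) =
      ∑ k, if σ k < k ∧ C k then cross σ k else 0 := by
  rw [countQuad, card_filter_eq_sum_card (β := Fin n) (γ := Fin n) _
    (fun x y => (σ x, σ y, x, y)) (fun a => a.2.2.1) (fun a => a.2.2.2)
    (by rintro ⟨i, j, k, l⟩ ⟨-, -, -, h, h', -⟩
        simp only at h h'
        rw [← h, ← h']) (fun _ _ => rfl) (fun _ _ => rfl)]
  refine Finset.sum_congr rfl fun k _ => ?_
  rw [card_filter_eq_ite (C := σ k < k ∧ C k) (P' := fun l => k < l ∧ σ l < k ∧ σ k < σ l)]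
  · exact ite_congr rfl (fun h => (cross_of_gt h.1).symm) fun _ => rfl
  · intro l
    constructor
    · rintro ⟨h1, h2, h3, -, -, h⟩
      exact ⟨⟨h1.trans h2, h⟩, h3, h2, h1⟩
    · rintro ⟨⟨-, h⟩, h3, h2, h1⟩
      exact ⟨h1, h2, h3, rfl, rfl, h⟩

theorem lower_nestings_eq (σ : Equiv.Perm (Fin n)) (C : Fin n → Prop) [DecidablePred C] :
    (countQuad fun i j k l => i = σ l ∧ j = σ k ∧ C k) =
      ∑ k, if σ k < k ∧ C k then rank σ k else 0 := by
  rw [countQuad, card_filter_eq_sum_card (β := Fin n) (γ := Fin n) _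
    (fun x y => (σ y, σ x, x, y)) (fun a => a.2.2.1) (fun a => a.2.2.2)
    (by rintro ⟨i, j, k, l⟩ ⟨-, -, -, h, h', -⟩
        simp only at h h'
        rw [← h, ← h']) (fun _ _ => rfl) (fun _ _ => rfl)]
  refine Finset.sum_congr rfl fun k _ => ?_
  rw [card_filter_eq_ite (C := σ k < k ∧ C k) (P' := fun l => k < l ∧ σ l < σ k)]
  · exact ite_congr rfl (fun h => (rank_of_gt h.1).symm) fun _ => rfl
  · intro l
    constructor
    · rintro ⟨h1, h2, h3, -, -, h⟩
      exact ⟨⟨h2, h⟩, h3, h1⟩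
    · rintro ⟨⟨h2, h⟩, h3, h1⟩
      exact ⟨h1, h2, h3, rfl, rfl, h⟩

theorem ucrosscval_eq (σ : Equiv.Perm (Fin n)) :
    ucrosscval σ = ∑ i, if kind σ i = .cval then cross σ i else 0 := by
  simp_rw [ucrosscval, upper_crossings_eq, ← isCval_iff, IsCval, and_comm]

theorem ucrosscdrise_eq (σ : Equiv.Perm (Fin n)) :
    ucrosscdrise σ = ∑ i, if kind σ i = .cdrise then cross σ i else 0 := by
  simp_rw [ucrosscdrise, upper_crossings_eq, ← isCdrise_iff, IsCdrise, and_comm]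

theorem lcrosscpeak_eq (σ : Equiv.Perm (Fin n)) :
    lcrosscpeak σ = ∑ i, if kind σ i = .cpeak then cross σ i else 0 := by
  simp_rw [lcrosscpeak, lower_crossings_eq, ← isCpeak_iff, IsCpeak, and_comm]

theorem lcrosscdfall_eq (σ : Equiv.Perm (Fin n)) :
    lcrosscdfall σ = ∑ i, if kind σ i = .cdfall then cross σ i else 0 := by
  simp_rw [lcrosscdfall, lower_crossings_eq, ← isCdfall_iff, IsCdfall, and_comm]

theorem unestcval_eq (σ : Equiv.Perm (Fin n)) :
    unestcval σ = ∑ i, if kind σ i = .cval then rank σ i else 0 := by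
  simp_rw [unestcval, upper_nestings_eq, ← isCval_iff, IsCval, and_comm]

theorem unestcdrise_eq (σ : Equiv.Perm (Fin n)) :
    unestcdrise σ = ∑ i, if kind σ i = .cdrise then rank σ i else 0 := by
  simp_rw [unestcdrise, upper_nestings_eq, ← isCdrise_iff, IsCdrise, and_comm]

theorem lnestcpeak_eq (σ : Equiv.Perm (Fin n)) :
    lnestcpeak σ = ∑ i, if kind σ i = .cpeak then rank σ i else 0 := by
  simp_rw [lnestcpeak, lower_nestings_eq, ← isCpeak_iff, IsCpeak, and_comm]

theorem lnestcdfall_eq (σ : Equiv.Perm (Fin n)) :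
    lnestcdfall σ = ∑ i, if kind σ i = .cdfall then rank σ i else 0 := by
  simp_rw [lnestcdfall, lower_nestings_eq, ← isCdfall_iff, IsCdfall, and_comm]

/-! ### Fixed points -/

theorem psnest_eq (σ : Equiv.Perm (Fin n)) :
    psnest σ = ∑ i, if kind σ i = .fix then lev i σ else 0 := by
  rw [psnest, card_filter_eq_sum_card (β := Fin n) (γ := Fin n) _
    (fun x y => (y, x, σ y)) (fun a => a.2.1) (fun a => a.1)
    (by rintro ⟨i, j, l⟩ ⟨-, -, h, -⟩; simp only at h; rw [← h]) (fun _ _ => rfl) (fun _ _ => rfl)]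
  refine Finset.sum_congr rfl fun j _ => ?_
  refine card_filter_eq_ite fun i => ?_
  rw [← apply_eq_iff]
  constructor
  · rintro ⟨h1, h2, -, h⟩
    exact ⟨h.symm, h1, h2⟩
  · rintro ⟨h, h1, h2⟩
    exact ⟨h1, h2, rfl, h.symm⟩

theorem lev_lt (σ : Equiv.Perm (Fin n)) (i : Fin n) : lev i σ < n := by
  have h : lev i σ ≤ (Finset.Iio i).card := by
    rw [lev, countIdx]
    exact Finset.card_le_card fun j hj => Finset.mem_Iio.2 (Finset.mem_filter.1 hj).2.1
  rw [Fin.card_Iio] at h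
  exact h.trans_lt i.2

theorem wFix_eq {R : Type*} [CommRing R] (w : ℕ → R) (σ : Equiv.Perm (Fin n)) :
    wFix w σ = ∏ i, if kind σ i = .fix then w (lev i σ) else 1 := by
  -- Fixed points are grouped by level; `lev_lt` ensures that the levels below `n` suffice.
  rw [← Finset.prod_filter, ← Finset.prod_fiberwise_of_maps_to (t := Finset.range n)
    (g := fun i => lev i σ) fun i _ => Finset.mem_range.2 (lev_lt σ i), wFix]
  refine Finset.prod_congr rfl fun l _ => ?_
  rw [Finset.filter_filter, Finset.prod_congr rfl (g := fun _ => w l), Finset.prod_const, fixLev,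
    countIdx]
  · simp only [apply_eq_iff]
  · intro i hi
    rw [(Finset.mem_filter.1 hi).2.2]

/-! ### The weight of a permutation -/

variable {R : Type*} [CommRing R]

/-- The weight of a crossing-nesting label `a ≤ m`: `x` or `u` according to whether `a = 0`, times
`p ^ (m - a) * q ^ a`. -/
def labelWeight (x u p q : R) (m a : ℕ) : R :=
  (if a = 0 then x else u) * (p ^ (m - a) * q ^ a)

theorem sum_labelWeight (x u p q : R) (m : ℕ) :
    ∑ a ∈ Finset.range (m + 1), labelWeight x u p q m a = p ^ m * x + q * pqInt p q m * u := by
  rw [Finset.sum_range_succ', add_comm]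
  congr 1
  · simp [labelWeight, mul_comm]
  -- The labels `a > 0` share a factor `q * u`; reversing the summation matches the exponents of
  -- `pqInt`.
  · rw [pqInt, ← Finset.sum_range_reflect, Finset.mul_sum, Finset.sum_mul]
    refine Finset.sum_congr rfl fun a ha => ?_
    have ha := Finset.mem_range.1 ha
    rw [labelWeight, if_neg (Nat.succ_ne_zero _), show m - (m - 1 - a + 1) = a by omega, pow_succ]
    ring

/-- The weight of a step of a code starting at height `h`. -/
def stepWeight (x1 x2 y1 y2 u1 u2 v1 v2 : R) (w : ℕ → R)
    (pa1 pa2 pb1 pb2 qa1 qa2 qb1 qb2 s : R) (h : ℕ) : Kind × ℕ → R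
  -- The fourth-from-last and last-but-one arguments `q` and `m` of `labelWeight` reflect the type:
  -- `m` is the number of arcs that cross or nest with the one from the index, namely `h` for `cval`
  -- and `h - 1` otherwise.
  | (.cval, a) => labelWeight y1 v1 pa1 qa1 h a
  | (.cdrise, a) => labelWeight y2 v2 pa2 qa2 (h - 1) a
  | (.cpeak, a) => labelWeight x1 u1 pb1 qb1 (h - 1) a
  | (.cdfall, a) => labelWeight x2 u2 pb2 qb2 (h - 1) a
  | (.fix, _) => s ^ h * w h

/-- Once all exponents are sums over indices, only the factors of its own type survive at each
index; the crossing number is then eliminated in favour of height and rank. -/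
theorem Q_eq_sum_prod (x1 x2 y1 y2 u1 u2 v1 v2 : R) (w : ℕ → R)
    (pa1 pa2 pb1 pb2 qa1 qa2 qb1 qb2 s : R) (n : ℕ) :
    Q n x1 x2 y1 y2 u1 u2 v1 v2 w pa1 pa2 pb1 pb2 qa1 qa2 qb1 qb2 s =
      ∑ σ : Equiv.Perm (Fin n), ∏ i : Fin n,
        stepWeight x1 x2 y1 y2 u1 u2 v1 v2 w pa1 pa2 pb1 pb2 qa1 qa2 qb1 qb2 s
          (openCount σ i) (kind σ i, rank σ i) := by
  refine Finset.sum_congr rfl fun σ _ => ?_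
  rw [eareccpeak_eq, eareccdfall_eq, ereccval_eq, ereccdrise_eq, nrcpeak_eq, nrcdfall_eq,
    nrcval_eq, nrcdrise_eq, wFix_eq, ucrosscval_eq, ucrosscdrise_eq, lcrosscpeak_eq,
    lcrosscdfall_eq, unestcval_eq, unestcdrise_eq, lnestcpeak_eq, lnestcdfall_eq, psnest_eq]
  simp only [← Finset.prod_pow_eq_pow_sum, ← Finset.prod_mul_distrib]
  refine Finset.prod_congr rfl fun i _ => ?_
  have h1 := lt_apply_iff (σ := σ) (i := i)
  have h2 := symm_lt_iff (σ := σ) (i := i)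
  have h3 := apply_lt_iff (σ := σ) (i := i)
  have h4 := openCount_eq σ i
  have h5 := cross_add_rank_of_lt (σ := σ) (i := i)
  have h6 := cross_add_rank_of_gt (σ := σ) (i := i)
  cases hk : kind σ i <;> simp only [hk, reduceCtorEq, or_false, or_true, iff_true, iff_false,
    or_self] at h1 h2 h3
  case cval =>
    have hm : cross σ i = openCount σ i - rank σ i := by
      rw [if_neg h2] at h4; have := h5 h1; omega
    by_cases h0 : rank σ i = 0 <;> simp [stepWeight, labelWeight, hm, h0, mul_assoc]
  case cdrise =>
    have hm : cross σ i = openCount σ i - 1 - rank σ i := by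
      rw [if_pos h2] at h4; have := h5 h1; omega
    by_cases h0 : rank σ i = 0 <;> simp [stepWeight, labelWeight, hm, h0, mul_assoc]
  case cpeak =>
    have hm : cross σ i = openCount σ i - 1 - rank σ i := by have := h6 h3; omega
    by_cases h0 : rank σ i = 0 <;> simp [stepWeight, labelWeight, hm, h0, mul_assoc]
  case cdfall =>
    have hm : cross σ i = openCount σ i - 1 - rank σ i := by have := h6 h3; omega
    by_cases h0 : rank σ i = 0 <;> simp [stepWeight, labelWeight, hm, h0, mul_assoc]
  case fix =>
    rw [if_neg h2, add_zero] at h4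
    simp [stepWeight, h4, mul_comm]

end PermJFrac

/-! ### Assembly of the continued fraction. -/

theorem theorem2p7 {R : Type*} [CommRing R] (x1 x2 y1 y2 u1 u2 v1 v2 : R) (w : ℕ → R)
    (pa1 pa2 pb1 pb2 qa1 qa2 qb1 qb2 s : R) (γ β : ℕ → R)
    (hγ0 : γ 0 = w 0)
    (hγ : ∀ n : ℕ, 1 ≤ n → γ n =
      (pb2 ^ (n - 1) * x2 + qb2 * PermJFrac.pqInt pb2 qb2 (n - 1) * u2) +
      (pa2 ^ (n - 1) * y2 + qa2 * PermJFrac.pqInt pa2 qa2 (n - 1) * v2) + s ^ n * w n)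
    (hβ : ∀ n : ℕ, 1 ≤ n → β n =
      (pb1 ^ (n - 1) * x1 + qb1 * PermJFrac.pqInt pb1 qb1 (n - 1) * u1) *
      (pa1 ^ (n - 1) * y1 + qa1 * PermJFrac.pqInt pa1 qa1 (n - 1) * v1)) :
    PermJFrac.IsJFraction
      (PowerSeries.mk fun n =>
        PermJFrac.Q n x1 x2 y1 y2 u1 u2 v1 v2 w pa1 pa2 pb1 pb2 qa1 qa2 qb1 qb2 s)
      γ β := by
  have key := PermJFrac.sum_codeWeight
    (PermJFrac.stepWeight x1 x2 y1 y2 u1 u2 v1 v2 w pa1 pa2 pb1 pb2 qa1 qa2 qb1 qb2 s)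
    (fun h => pa1 ^ h * y1 + qa1 * PermJFrac.pqInt pa1 qa1 h * v1) γ
    (fun h => pb1 ^ h * x1 + qb1 * PermJFrac.pqInt pb1 qb1 h * u1)
    (fun h => PermJFrac.sum_labelWeight _ _ _ _ h)
    (fun h => by
      cases h with
      -- At height `0` the only level step is a fixed point, of weight `w 0`.
      | zero => simp [PermJFrac.stepWeight, hγ0]
      | succ h =>
        simp only [PermJFrac.stepWeight, Nat.add_sub_cancel, PermJFrac.sum_labelWeight]
        rw [hγ (h + 1) (Nat.succ_pos h), Nat.add_sub_cancel]
        ring)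
    -- A fall starts at `h + 1`, so the label bound `h + 1 - 1` is `h`.
    (fun h => PermJFrac.sum_labelWeight _ _ _ _ h)
  simp_rw [PermJFrac.Q_eq_sum_prod, PermJFrac.sum_perm_eq_sum_codes, key]
  refine PermJFrac.isJFraction_motzkin _ _ _ _ fun h => ?_
  rw [hβ (h + 1) (Nat.succ_pos h), Nat.add_sub_cancel, mul_comm]
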